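/- **Conventions.** A monoid $S$ is *right LCM* if it is left cancellative and the intersection of any two principal right ideals $sS\cap tS$ is empty or again a principal right ideal; $S^*$ is its group of invertible elements. Write $s\perp t$ if $sS\cap tS=\emptyset$. A finite subset $F\subset S$ is a *foundation set* if for every $s\in S$ there is $f\in F$ with $f\not\perp s$; it is *accurate* if $f\perp f'$ for all distinct $f,f'\in F$. A foundation set $F'$ *refines* a foundation set $F$ if $F'\subset FS$, and $S$ has *property (AR)* if every foundation set has an accurate refinement. For a left cancellative monoid $S$, let $\mathcal J(S)$ be the smallest family of subsets of $S$ that contains $S$ and $\emptyset$ and is closed under $X\mapsto sX$, $X\mapsto s^{-1}X=\{t\in S: st\in X\}$ $(s\in S)$ and finite intersections. $C^*(S)$ is the universal unital $C^*$-algebra generated by isometries $v_s$ $(s\in S)$ and projections $e_X$ $(X\in\mathcal J(S))$ with $v_{st}=v_sv_t$, $v_se_Xv_s^*=e_{sX}$, $e_S=1$, $e_\emptyset=0$ and $e_{X\cap Y}=e_Xe_Y$. The *boundary quotient* $\mathcal Q(S)$ is the quotient of $C^*(S)$ by the relations $\prod_{f\in F}(1-e_{fS})=0$ for all foundation sets $F$.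 A simple undirected graph $\Gamma=(V,E)$ is *coconnected* if there is no partition $V=V_1\sqcup V_2$ into nonempty sets with $V_1\times V_2\subset E$. The *graph product* $S_\Gamma$ of monoids $(S_v)_{v\in V}$ is the quotient of their free product by the congruence generated by $st\sim ts$ for $s\in S_v$, $t\in S_w$, $(v,w)\in E$. **Theorem.** Let $\Gamma=(V,E)$ be a coconnected graph with at least two vertices, and let $(S_v)_{v\in V}$ be a family of right LCM monoids, each with more than one element. (i) If $\Gamma$ is infinite, then every foundation set for $S_\Gamma$ contains an invertible element. In particular, $S_\Gamma$ has property (AR), and $C^*(S_\Gamma)=\mathcal Q(S_\Gamma)$, that is, the canonical $*$-homomorphism $C^*(S_\Gamma)\to\mathcal Q(S_\Gamma)$ is an isomorphism. (ii) Suppose that $\Gamma$ is finite and $E\neq\emptyset$, and that either there is an edge $(u,v)\in E$ such that neither $S_u$ nor $S_v$ is a finite group (equivalently, $S_u$ and $S_v$ are infinite), or $S_\Gamma$ is a group. Then the accurate foundation sets for $S_\Gamma$ are exactly the singletons $\{x\}$ with $x\in S_\Gamma^*$. In particular, $S_\Gamma$ has property (AR) if and only if $S_\Gamma$ has no foundation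 set without invertible elements. -/

import Mathlib

/-! ### Right LCM monoids, foundation sets, property (AR) -/

section Monoids

variable {S : Type*} [Monoid S]

/-- The principal right ideal `sS`. -/
def principalRightIdeal (s : S) : Set S := {x | ∃ t, x = s * t}

/-- A right LCM monoid: left cancellative, and the intersection of two principal right ideals
is empty or again a principal right ideal. -/
structure IsRightLCM (S : Type*) [Monoid S] : Prop where
  left_cancel : ∀ a b c : S, a * b = a * c → b = c
  inter : ∀ s t : S, principalRightIdeal s ∩ principalRightIdeal t = ∅ ∨
    ∃ r : S, principalRightIdeal s ∩ principalRightIdeal t = principalRightIdeal r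

/-- Orthogonality `s ⊥ t`, i.e. `sS ∩ tS = ∅`. -/
def Orthogonal (s t : S) : Prop := principalRightIdeal s ∩ principalRightIdeal t = ∅

/-- A foundation set: a finite set `F ⊆ S` such that every `s ∈ S` is non-orthogonal to some
`f ∈ F`. -/
def IsFoundationSet (F : Set S) : Prop := F.Finite ∧ ∀ s : S, ∃ f ∈ F, ¬ Orthogonal f s

/-- A set whose distinct elements are orthogonal. -/
def IsAccurate (F : Set S) : Prop := ∀ f ∈ F, ∀ f' ∈ F, f ≠ f' → Orthogonal f f'

/-- For foundation sets `F` and `F'`: `F'` is a refinement of `F` if `F' ⊆ FS`. -/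
def IsRefinement (F' F : Set S) : Prop := ∀ f' ∈ F', ∃ f ∈ F, ∃ s : S, f' = f * s

/-- Property (AR): every foundation set has an accurate refinement (which is itself a
foundation set). -/
def HasAR (S : Type*) [Monoid S] : Prop :=
  ∀ F : Set S, IsFoundationSet F →
    ∃ F' : Set S, IsFoundationSet F' ∧ IsAccurate F' ∧ IsRefinement F' F

end Monoids

/-! ### Coconnected graphs and graph products -/

section GraphProducts

variable {V : Type*}

/-- There is no partition `V = A ⊔ Aᶜ` into nonempty sets with `A × Aᶜ ⊆ E`. -/
def IsCoconnected (Γ : SimpleGraph V) : Prop :=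
  ¬ ∃ A : Set V, A.Nonempty ∧ Aᶜ.Nonempty ∧ ∀ u ∈ A, ∀ w ∈ Aᶜ, Γ.Adj u w

/-- The pairs `(st, ts)` with `s ∈ S_v`, `t ∈ S_w` and `v`, `w` adjacent. -/
inductive GraphProductRel (Γ : SimpleGraph V) (S : V → Type*) [∀ v, Monoid (S v)] :
    Monoid.CoprodI S → Monoid.CoprodI S → Prop
  | comm {v w : V} (h : Γ.Adj v w) (s : S v) (t : S w) : GraphProductRel Γ S
      (Monoid.CoprodI.of s * Monoid.CoprodI.of t) (Monoid.CoprodI.of t * Monoid.CoprodI.of s)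

/-- The graph product `S_Γ`: the quotient of the free product of the monoids `S_v` by the
congruence that makes `S_v` and `S_w` commute whenever `v` and `w` are adjacent. -/
abbrev GraphProduct (Γ : SimpleGraph V) (S : V → Type*) [∀ v, Monoid (S v)] : Type _ :=
  (conGen (GraphProductRel Γ S)).Quotient

end GraphProducts

/-! ### The free unital complex `*`-algebra on a type of generators -/

noncomputable section

universe u w

/-- The free unital complex `*`-algebra on `G`: the monoid algebra of words in the letters
`(g, false)` (standing for `g`) and `(g, true)` (standing for `star g`). -/
def FreeStarAlgebra (G : Type u) : Type u := MonoidAlgebra ℂ (FreeMonoid (G × Bool))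

namespace FreeStarAlgebra

variable {G : Type u}

instance : Ring (FreeStarAlgebra G) :=
  inferInstanceAs (Ring (MonoidAlgebra ℂ (FreeMonoid (G × Bool))))

instance : Algebra ℂ (FreeStarAlgebra G) :=
  inferInstanceAs (Algebra ℂ (MonoidAlgebra ℂ (FreeMonoid (G × Bool))))

/-- A letter as an element of the free `*`-algebra. -/
def letter (x : G × Bool) : FreeStarAlgebra G :=
  MonoidAlgebra.of ℂ (FreeMonoid (G × Bool)) (FreeMonoid.of x)

/-- A generator as an element of the free `*`-algebra. -/
def gen (g : G) : FreeStarAlgebra G := letter (g, false)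

theorem induction {P : FreeStarAlgebra G → Prop} (one : P 1) (letter_ : ∀ x, P (letter x))
    (add : ∀ a b, P a → P b → P (a + b)) (mul : ∀ a b, P a → P b → P (a * b))
    (smul : ∀ (c : ℂ) a, P a → P (c • a)) (a : FreeStarAlgebra G) : P a := by
  refine MonoidAlgebra.induction_on (motive := P) a (fun m => ?_) add smul
  induction m using FreeMonoid.inductionOn' with
  | one => rw [map_one]; exact one
  | of_mul x m ih => rw [map_mul]; exact mul _ _ (letter_ x) ih

/-- The adjoint as a ring homomorphism into the opposite ring: it conjugates scalars and sends
`(g, b)` to `(g, !b)`. -/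
def starHom : FreeStarAlgebra G →+* (FreeStarAlgebra G)ᵐᵒᵖ :=
  MonoidAlgebra.liftNCRingHom
    ((algebraMap ℂ (FreeStarAlgebra G)ᵐᵒᵖ).comp (starRingEnd ℂ))
    (FreeMonoid.lift fun x : G × Bool => MulOpposite.op (letter (x.1, !x.2)))
    (fun c _ => Algebra.commutes (starRingEnd ℂ c) _)

theorem starHom_letter (x : G × Bool) :
    starHom (letter x) = MulOpposite.op (letter (x.1, !x.2)) := by
  simp only [starHom, letter, MonoidAlgebra.of_apply]
  erw [MonoidAlgebra.liftNCRingHom_single]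
  simp

theorem starHom_smul (c : ℂ) (a : FreeStarAlgebra G) :
    starHom (c • a) = (starRingEnd ℂ c) • starHom a := by
  have h : starHom (algebraMap ℂ (FreeStarAlgebra G) c)
      = algebraMap ℂ (FreeStarAlgebra G)ᵐᵒᵖ (starRingEnd ℂ c) := by
    have : algebraMap ℂ (FreeStarAlgebra G) c
        = (MonoidAlgebra.single 1 c : MonoidAlgebra ℂ (FreeMonoid (G × Bool))) := rfl
    rw [this]
    simp only [starHom]
    erw [MonoidAlgebra.liftNCRingHom_single]
    simp
  rw [Algebra.smul_def, map_mul, h, ← Algebra.smul_def]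

instance : StarRing (FreeStarAlgebra G) where
  star a := (starHom a).unop
  star_involutive a := by
    show (starHom (starHom a).unop).unop = a
    induction a using induction with
    | one => simp
    | letter_ x => simp [starHom_letter]
    | add a b ha hb => simp [ha, hb]
    | mul a b ha hb => simp [ha, hb]
    | smul c a ha => simp [starHom_smul, ha]
  star_mul a b := by
    show (starHom (a * b)).unop = (starHom b).unop * (starHom a).unop
    simp
  star_add a b := by
    show (starHom (a + b)).unop = (starHom a).unop + (starHom b).unop
    simp

theorem star_def (a : FreeStarAlgebra G) : star a = (starHom a).unop := rfl

theorem star_letter (x : G × Bool) : star (letter x) = letter (x.1, !x.2) := by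
  rw [star_def, starHom_letter, MulOpposite.unop_op]

instance : StarModule ℂ (FreeStarAlgebra G) where
  star_smul c a := by
    rw [star_def, starHom_smul, MulOpposite.unop_smul]; rfl

/-- The evaluation of `*`-polynomials at a family of elements of a complex `*`-algebra. -/
def eval {B : Type w} [Ring B] [StarRing B] [Algebra ℂ B] [StarModule ℂ B] (φ : G → B) :
    FreeStarAlgebra G →⋆ₐ[ℂ] B :=
  let f : FreeStarAlgebra G →ₐ[ℂ] B := MonoidAlgebra.lift ℂ B (FreeMonoid (G × Bool))
    (FreeMonoid.lift fun x : G × Bool => if x.2 then star (φ x.1) else φ x.1)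
  { f with
    map_star' := fun a => by
      have hl : ∀ x : G × Bool, f (letter x) = if x.2 then star (φ x.1) else φ x.1 := by
        intro x
        simp only [f, letter]
        erw [MonoidAlgebra.lift_of]
        simp
      show f (star a) = star (f a)
      induction a using induction with
      | one => simp
      | letter_ x => rw [star_letter, hl, hl]; rcases x with ⟨g, b⟩; cases b <;> simp
      | add a b ha hb => simp [ha, hb]
      | mul a b ha hb => simp [ha, hb]
      | smul c a ha => simp [star_smul, ha] }

theorem eval_gen {B : Type w} [Ring B] [StarRing B] [Algebra ℂ B] [StarModule ℂ B] (φ : G → B)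
    (g : G) : eval φ (gen g) = φ g := by
  show MonoidAlgebra.lift ℂ B (FreeMonoid (G × Bool)) _ (letter (g, false)) = φ g
  simp only [letter]
  erw [MonoidAlgebra.lift_of]
  simp

end FreeStarAlgebra

/-! ### Universal C*-algebras -/

open FreeStarAlgebra

section UniversalCStar

variable {G : Type u}

/-- A C*-seminorm on the free `*`-algebra that is at most `1` on the generators and for which the
relations `a = b`, `r a b`, hold. -/
structure AdmissibleSeminorm (r : FreeStarAlgebra G → FreeStarAlgebra G → Prop) where
  /-- The underlying seminorm of complex vector spaces. -/
  toSeminorm : Seminorm ℂ (FreeStarAlgebra G)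
  mul_le : ∀ a b, toSeminorm (a * b) ≤ toSeminorm a * toSeminorm b
  star_mul_self : ∀ a, toSeminorm (star a * a) = toSeminorm a ^ 2
  gen_le : ∀ g, toSeminorm (gen g) ≤ 1
  rel : ∀ a b, r a b → toSeminorm (a - b) = 0

variable {r : FreeStarAlgebra G → FreeStarAlgebra G → Prop}

namespace AdmissibleSeminorm

variable (p : AdmissibleSeminorm r)

theorem star_le (a : FreeStarAlgebra G) : p.toSeminorm a ≤ p.toSeminorm (star a) := by
  have h1 : p.toSeminorm (star a * a) = p.toSeminorm a ^ 2 := p.star_mul_self a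
  have h2 : p.toSeminorm (star a * a) ≤ p.toSeminorm (star a) * p.toSeminorm a := p.mul_le _ _
  have h3 := apply_nonneg p.toSeminorm a
  have h4 := apply_nonneg p.toSeminorm (star a)
  by_contra h
  push Not at h
  nlinarith

theorem star_eq (a : FreeStarAlgebra G) : p.toSeminorm (star a) = p.toSeminorm a :=
  le_antisymm (by simpa using p.star_le (star a)) (p.star_le a)

theorem one_le : p.toSeminorm 1 ≤ 1 := by
  have h1 : p.toSeminorm (star 1 * 1) = p.toSeminorm 1 ^ 2 := p.star_mul_self 1
  rw [star_one, one_mul] at h1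
  by_contra h
  push Not at h
  nlinarith

instance : Nonempty (AdmissibleSeminorm r) :=
  ⟨{  toSeminorm := 0
      mul_le := fun a b => by simp
      star_mul_self := fun a => by simp
      gen_le := fun g => by simp
      rel := fun a b _ => by simp }⟩

theorem bddAbove (r : FreeStarAlgebra G → FreeStarAlgebra G → Prop) (a : FreeStarAlgebra G) :
    BddAbove (Set.range fun p : AdmissibleSeminorm r => p.toSeminorm a) := by
  suffices h : ∃ C : ℝ, ∀ p : AdmissibleSeminorm r, p.toSeminorm a ≤ C by
    obtain ⟨C, hC⟩ := h
    exact ⟨C, by rintro _ ⟨p, rfl⟩; exact hC p⟩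
  induction a using FreeStarAlgebra.induction with
  | one => exact ⟨1, fun p => p.one_le⟩
  | letter_ x =>
    refine ⟨1, fun p => ?_⟩
    rcases x with ⟨g, b⟩
    cases b
    · exact p.gen_le g
    · have h : letter (g, true) = star (gen g) := by simp [gen, star_letter]
      rw [h, p.star_eq]
      exact p.gen_le g
  | add a b ha hb =>
    obtain ⟨C, hC⟩ := ha
    obtain ⟨D, hD⟩ := hb
    exact ⟨C + D, fun p => (map_add_le_add _ _ _).trans (add_le_add (hC p) (hD p))⟩
  | mul a b ha hb =>
    obtain ⟨C, hC⟩ := ha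
    obtain ⟨D, hD⟩ := hb
    exact ⟨C * D, fun p => (p.mul_le _ _).trans (mul_le_mul (hC p) (hD p)
      (apply_nonneg p.toSeminorm _) ((apply_nonneg p.toSeminorm _).trans (hC p)))⟩
  | smul c a ha =>
    obtain ⟨C, hC⟩ := ha
    refine ⟨‖c‖ * C, fun p => ?_⟩
    rw [map_smul_eq_mul]
    exact mul_le_mul_of_nonneg_left (hC p) (norm_nonneg c)

end AdmissibleSeminorm

/-- The largest admissible C*-seminorm. -/
def maxSeminorm (r : FreeStarAlgebra G → FreeStarAlgebra G → Prop) (a : FreeStarAlgebra G) : ℝ :=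
  ⨆ p : AdmissibleSeminorm r, p.toSeminorm a

theorem le_maxSeminorm (p : AdmissibleSeminorm r) (a : FreeStarAlgebra G) :
    p.toSeminorm a ≤ maxSeminorm r a := le_ciSup (AdmissibleSeminorm.bddAbove r a) p

theorem maxSeminorm_nonneg (a : FreeStarAlgebra G) : 0 ≤ maxSeminorm r a :=
  (apply_nonneg (Classical.arbitrary (AdmissibleSeminorm r)).toSeminorm a).trans
    (le_maxSeminorm _ a)

/-- The free `*`-algebra, seminormed by the largest admissible C*-seminorm. -/
def PreUniversalCStar (r : FreeStarAlgebra G → FreeStarAlgebra G → Prop) : Type u :=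
  let _ := r
  FreeStarAlgebra G

namespace PreUniversalCStar

instance : Ring (PreUniversalCStar r) := inferInstanceAs (Ring (FreeStarAlgebra G))

instance : Algebra ℂ (PreUniversalCStar r) := inferInstanceAs (Algebra ℂ (FreeStarAlgebra G))

instance : StarRing (PreUniversalCStar r) := inferInstanceAs (StarRing (FreeStarAlgebra G))

instance : StarModule ℂ (PreUniversalCStar r) :=
  inferInstanceAs (StarModule ℂ (FreeStarAlgebra G))

/-- The identity map from the free `*`-algebra to its seminormed copy. -/
def toPre (r : FreeStarAlgebra G → FreeStarAlgebra G → Prop) :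
    FreeStarAlgebra G →⋆ₐ[ℂ] PreUniversalCStar r := StarAlgHom.id ℂ (FreeStarAlgebra G)

/-- Evaluation of `*`-polynomials, on the seminormed copy of the free `*`-algebra. -/
def evalPre {B : Type w} [Ring B] [StarRing B] [Algebra ℂ B] [StarModule ℂ B]
    (r : FreeStarAlgebra G → FreeStarAlgebra G → Prop) (φ : G → B) :
    PreUniversalCStar r →⋆ₐ[ℂ] B := eval φ

/-- The largest admissible C*-seminorm as a seminorm of additive groups. -/
def addGroupSeminorm (r : FreeStarAlgebra G → FreeStarAlgebra G → Prop) :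
    AddGroupSeminorm (PreUniversalCStar r) where
  toFun := maxSeminorm r
  map_zero' := by
    refine le_antisymm (ciSup_le fun p => ?_) (maxSeminorm_nonneg _)
    exact (map_zero p.toSeminorm).le
  add_le' a b := ciSup_le fun p =>
    (map_add_le_add p.toSeminorm a b).trans (add_le_add (le_maxSeminorm p a) (le_maxSeminorm p b))
  neg' a := by
    refine congrArg iSup (funext fun p => ?_)
    exact map_neg_eq_map p.toSeminorm a

instance : SeminormedRing (PreUniversalCStar r) :=
  { (addGroupSeminorm r).toSeminormedAddCommGroup, (inferInstance : Ring (PreUniversalCStar r)) with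
    norm_mul_le := fun a b => ciSup_le fun p => (p.mul_le a b).trans
      (mul_le_mul (le_maxSeminorm p a) (le_maxSeminorm p b) (apply_nonneg p.toSeminorm b)
        (maxSeminorm_nonneg a)) }

theorem norm_def (a : PreUniversalCStar r) : ‖a‖ = maxSeminorm r a := rfl

instance : NormedAlgebra ℂ (PreUniversalCStar r) where
  norm_smul_le c a := ciSup_le fun p => by
    refine (map_smul_eq_mul p.toSeminorm c a).le.trans ?_
    exact mul_le_mul_of_nonneg_left (le_maxSeminorm p a) (norm_nonneg c)

theorem norm_star (a : PreUniversalCStar r) : ‖star a‖ = ‖a‖ :=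
  congrArg iSup (funext fun p => AdmissibleSeminorm.star_eq p a)

theorem norm_sq_le (a : PreUniversalCStar r) : ‖a‖ * ‖a‖ ≤ ‖star a * a‖ := by
  have h : ‖a‖ ≤ Real.sqrt ‖star a * a‖ := ciSup_le fun p => by
    refine Real.le_sqrt_of_sq_le ?_
    exact (p.star_mul_self a).symm.le.trans (le_maxSeminorm p _)
  calc ‖a‖ * ‖a‖ ≤ Real.sqrt ‖star a * a‖ * Real.sqrt ‖star a * a‖ :=
        mul_self_le_mul_self (norm_nonneg a) h
    _ = ‖star a * a‖ := Real.mul_self_sqrt (norm_nonneg _)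

instance : NormedStarGroup (PreUniversalCStar r) where
  norm_star_le a := (norm_star a).le

end PreUniversalCStar

/-- The universal unital C*-algebra on contractive generators indexed by `G`, subject to the
relations `a = b` for all `*`-polynomials with `r a b`: the Hausdorff completion of the free
`*`-algebra in the largest admissible C*-seminorm. -/
def UniversalCStar (r : FreeStarAlgebra G → FreeStarAlgebra G → Prop) : Type u :=
  UniformSpace.Completion (PreUniversalCStar r)

namespace UniversalCStar

open UniformSpace PreUniversalCStar

instance : NormedRing (UniversalCStar r) :=
  inferInstanceAs (NormedRing (Completion (PreUniversalCStar r)))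

instance : NormedAlgebra ℂ (UniversalCStar r) :=
  { (inferInstance : Algebra ℂ (Completion (PreUniversalCStar r))) with
    norm_smul_le := fun c a => norm_smul_le (β := Completion (PreUniversalCStar r)) c a }

instance : CompleteSpace (UniversalCStar r) :=
  inferInstanceAs (CompleteSpace (Completion (PreUniversalCStar r)))

/-- The canonical map from the free `*`-algebra. -/
def coe (a : PreUniversalCStar r) : UniversalCStar r := (a : Completion (PreUniversalCStar r))

theorem uniformContinuous_star :
    UniformContinuous (star : PreUniversalCStar r → PreUniversalCStar r) :=
  (starₗᵢ ℂ : PreUniversalCStar r ≃ₗᵢ⋆[ℂ] PreUniversalCStar r).isometry.uniformContinuous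

instance : Star (UniversalCStar r) :=
  ⟨Completion.map (star : PreUniversalCStar r → PreUniversalCStar r)⟩

theorem continuous_star : Continuous (star : UniversalCStar r → UniversalCStar r) :=
  Completion.continuous_map

theorem coe_star (a : PreUniversalCStar r) : coe (star a) = star (coe a) :=
  (Completion.map_coe uniformContinuous_star a).symm

theorem coe_add (a b : PreUniversalCStar r) : coe (a + b) = coe a + coe b :=
  Completion.coe_add a b

theorem coe_mul (a b : PreUniversalCStar r) : coe (a * b) = coe a * coe b :=
  Completion.coe_mul a b

theorem coe_smul (c : ℂ) (a : PreUniversalCStar r) : coe (c • a) = c • coe a :=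
  Completion.coe_smul c a

theorem norm_coe (a : PreUniversalCStar r) : ‖coe a‖ = ‖a‖ := Completion.norm_coe a

theorem denseRange_coe : DenseRange (coe : PreUniversalCStar r → UniversalCStar r) :=
  Completion.denseRange_coe

theorem continuous_coe : Continuous (coe : PreUniversalCStar r → UniversalCStar r) :=
  Completion.continuous_coe _

theorem induction {P : UniversalCStar r → Prop} (closed : IsClosed {x | P x})
    (h : ∀ a : PreUniversalCStar r, P (coe a)) (x : UniversalCStar r) : P x :=
  Completion.induction_on x closed h

instance : StarRing (UniversalCStar r) where
  star_involutive x := by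
    induction x using induction with
    | closed => exact isClosed_eq (continuous_star.comp continuous_star) continuous_id
    | h a => rw [← coe_star, ← coe_star, star_star]
  star_mul x y := by
    refine denseRange_coe.induction_on₂
      (p := fun x y : UniversalCStar r => star (x * y) = star y * star x) ?_ ?_ x y
    · exact isClosed_eq (continuous_star.comp continuous_mul)
        ((continuous_star.comp continuous_snd).mul (continuous_star.comp continuous_fst))
    · intro a b
      rw [← coe_mul, ← coe_star, ← coe_star, ← coe_star, ← coe_mul, star_mul]
  star_add x y := by
    refine denseRange_coe.induction_on₂
      (p := fun x y : UniversalCStar r => star (x + y) = star x + star y) ?_ ?_ x y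
    · exact isClosed_eq (continuous_star.comp continuous_add)
        ((continuous_star.comp continuous_fst).add (continuous_star.comp continuous_snd))
    · intro a b
      rw [← coe_add, ← coe_star, ← coe_star, ← coe_star, ← coe_add, star_add]

instance : StarModule ℂ (UniversalCStar r) where
  star_smul c x := by
    induction x using induction with
    | closed =>
      exact isClosed_eq (continuous_star.comp (continuous_const_smul c))
        (continuous_star.const_smul (star c))
    | h a => rw [← coe_smul, ← coe_star, ← coe_star, ← coe_smul, star_smul]

instance : CStarRing (UniversalCStar r) where
  norm_mul_self_le x := by
    induction x using induction with
    | closed =>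
      exact isClosed_le (continuous_norm.mul continuous_norm)
        (continuous_norm.comp (continuous_star.mul continuous_id))
    | h a =>
      rw [← coe_star, ← coe_mul, norm_coe, norm_coe]
      exact PreUniversalCStar.norm_sq_le a

instance : CStarAlgebra (UniversalCStar r) where

/-- The image of a generator in the universal C*-algebra. -/
def ι (g : G) : UniversalCStar r := coe (toPre r (gen g))

section Lift

variable {B : Type w} [CStarAlgebra B]

/-- A contractive family in a C*-algebra that satisfies the relations gives an admissible
C*-seminorm. -/
def seminormOfFamily (φ : G → B) (hφ : ∀ g, ‖φ g‖ ≤ 1) (hr : ∀ a b, r a b → eval φ a = eval φ b) :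
    AdmissibleSeminorm r where
  toSeminorm := (normSeminorm ℂ B).comp (eval φ : FreeStarAlgebra G →⋆ₐ[ℂ] B).toAlgHom.toLinearMap
  mul_le a b := by
    show ‖eval φ (a * b)‖ ≤ ‖eval φ a‖ * ‖eval φ b‖
    rw [map_mul]
    exact norm_mul_le _ _
  star_mul_self a := by
    show ‖eval φ (star a * a)‖ = ‖eval φ a‖ ^ 2
    rw [map_mul, map_star, CStarRing.norm_star_mul_self, sq]
  gen_le g := by
    show ‖eval φ (gen g)‖ ≤ 1
    rw [eval_gen]
    exact hφ g
  rel a b h := by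
    show ‖eval φ (a - b)‖ = 0
    rw [map_sub, hr a b h, sub_self, norm_zero]

theorem norm_evalPre_le (φ : G → B) (hφ : ∀ g, ‖φ g‖ ≤ 1)
    (hr : ∀ a b, r a b → eval φ a = eval φ b) (a : PreUniversalCStar r) :
    ‖evalPre r φ a‖ ≤ ‖a‖ := le_maxSeminorm (seminormOfFamily φ hφ hr) a

theorem continuous_evalPre (φ : G → B) (hφ : ∀ g, ‖φ g‖ ≤ 1)
    (hr : ∀ a b, r a b → eval φ a = eval φ b) :
    Continuous (evalPre r φ : PreUniversalCStar r →+* B) :=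
  ((evalPre r φ).toAlgHom.toLinearMap.mkContinuous 1
    (fun a => by rw [one_mul]; exact norm_evalPre_le φ hφ hr a)).continuous

/-- The ring homomorphism that underlies `lift`. -/
def liftRingHom (φ : G → B) (hφ : ∀ g, ‖φ g‖ ≤ 1) (hr : ∀ a b, r a b → eval φ a = eval φ b) :
    UniversalCStar r →+* B :=
  Completion.extensionHom (evalPre r φ : PreUniversalCStar r →+* B) (continuous_evalPre φ hφ hr)

theorem liftRingHom_coe (φ : G → B) (hφ : ∀ g, ‖φ g‖ ≤ 1)
    (hr : ∀ a b, r a b → eval φ a = eval φ b) (a : PreUniversalCStar r) :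
    liftRingHom φ hφ hr (coe a) = evalPre r φ a :=
  Completion.extensionHom_coe (evalPre r φ : PreUniversalCStar r →+* B)
    (continuous_evalPre φ hφ hr) a

theorem continuous_liftRingHom (φ : G → B) (hφ : ∀ g, ‖φ g‖ ≤ 1)
    (hr : ∀ a b, r a b → eval φ a = eval φ b) : Continuous (liftRingHom φ hφ hr) :=
  Completion.continuous_extension

/-- The `*`-homomorphism from the universal C*-algebra given by a contractive family of elements of
a C*-algebra that satisfies the relations. -/
def lift (φ : G → B) (hφ : ∀ g, ‖φ g‖ ≤ 1) (hr : ∀ a b, r a b → eval φ a = eval φ b) :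
    UniversalCStar r →⋆ₐ[ℂ] B :=
  { liftRingHom φ hφ hr with
    commutes' := fun c => by
      show liftRingHom φ hφ hr (coe (algebraMap ℂ (PreUniversalCStar r) c)) = _
      rw [liftRingHom_coe]
      exact AlgHomClass.commutes (evalPre r φ) c
    map_star' := fun x => by
      show liftRingHom φ hφ hr (star x) = star (liftRingHom φ hφ hr x)
      induction x using induction with
      | closed =>
        exact isClosed_eq ((continuous_liftRingHom φ hφ hr).comp continuous_star)
          (continuous_liftRingHom φ hφ hr).star
      | h a =>
        rw [← coe_star, liftRingHom_coe, liftRingHom_coe]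
        exact map_star (evalPre r φ) a }

theorem lift_ι (φ : G → B) (hφ : ∀ g, ‖φ g‖ ≤ 1) (hr : ∀ a b, r a b → eval φ a = eval φ b)
    (g : G) : lift φ hφ hr (ι g) = φ g :=
  (liftRingHom_coe φ hφ hr (toPre r (gen g))).trans (eval_gen φ g)

end Lift

/-- Relations hold in the universal C*-algebra. -/
theorem coe_eq_of_rel {a b : FreeStarAlgebra G} (h : r a b) :
    (coe (toPre r a) : UniversalCStar r) = coe (toPre r b) := by
  have h0 : ‖(coe (toPre r (a - b)) : UniversalCStar r)‖ = 0 := by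
    rw [norm_coe]
    refine le_antisymm (ciSup_le fun p => ?_) (norm_nonneg _)
    exact (p.rel a b h).le
  have h1 : (coe (toPre r (a - b)) : UniversalCStar r) = coe (toPre r a) - coe (toPre r b) := by
    rw [map_sub]
    exact Completion.coe_sub _ _
  rw [norm_eq_zero, h1] at h0
  exact sub_eq_zero.mp h0

theorem norm_ι_le (g : G) : ‖(ι g : UniversalCStar r)‖ ≤ 1 := by
  rw [ι, norm_coe]
  exact ciSup_le fun p => p.gen_le g

theorem eval_ι (a : FreeStarAlgebra G) :
    eval (ι : G → UniversalCStar r) a = coe (toPre r a) := by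
  have hg : ∀ g, eval (ι : G → UniversalCStar r) (gen g) = coe (toPre r (gen g)) := eval_gen _
  induction a using FreeStarAlgebra.induction with
  | one => rw [map_one, map_one]; rfl
  | letter_ x =>
    rcases x with ⟨g, b⟩
    cases b
    · exact hg g
    · have h : letter (g, true) = star (gen g) := by simp [gen, star_letter]
      rw [h, map_star, hg, map_star, coe_star]
  | add a b ha hb => rw [map_add, ha, hb, map_add, coe_add]
  | mul a b ha hb => rw [map_mul, ha, hb, map_mul, coe_mul]
  | smul c a ha => rw [map_smul, ha, map_smul, coe_smul]

/-- Adding relations: the canonical `*`-homomorphism that is the identity on generators. -/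
def mapOfImp {r' : FreeStarAlgebra G → FreeStarAlgebra G → Prop} (h : ∀ a b, r a b → r' a b) :
    UniversalCStar r →⋆ₐ[ℂ] UniversalCStar r' :=
  lift ι norm_ι_le (fun a b hab => by rw [eval_ι, eval_ι]; exact coe_eq_of_rel (h a b hab))

end UniversalCStar

end UniversalCStar

/-! ### The full semigroup C*-algebra and its boundary quotient -/

section SemigroupCStar

variable (S : Type u) [Monoid S]

/-- The constructible right ideals of `S`: the smallest family of subsets of `S` that contains `S`
and `∅` and is closed under `X ↦ sX`, `X ↦ s⁻¹X = {t | st ∈ X}` and finite intersections. -/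
inductive IsConstructible : Set S → Prop
  | univ : IsConstructible Set.univ
  | empty : IsConstructible ∅
  | image (s : S) {X : Set S} : IsConstructible X → IsConstructible ((fun t => s * t) '' X)
  | preimage (s : S) {X : Set S} : IsConstructible X → IsConstructible ((fun t => s * t) ⁻¹' X)
  | inter {X Y : Set S} : IsConstructible X → IsConstructible Y → IsConstructible (X ∩ Y)

theorem IsConstructible.principal (s : S) : IsConstructible S (principalRightIdeal s) := by
  have h : principalRightIdeal s = (fun t => s * t) '' Set.univ := by
    ext x
    simp [principalRightIdeal, eq_comm]
  rw [h]
  exact IsConstructible.image s IsConstructible.univ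

/-- The generators of the semigroup C*-algebra: `v_s` for `s ∈ S`, and `e_X` for constructible right
ideals `X`. -/
inductive CStarGen : Type u
  | v (s : S) : CStarGen
  | e (X : Set S) (hX : IsConstructible S X) : CStarGen

variable {S}

/-- The generator `v_s` in the free `*`-algebra. -/
def genV (s : S) : FreeStarAlgebra (CStarGen S) := gen (CStarGen.v s)

/-- The generator `e_X` in the free `*`-algebra. -/
def genE (X : Set S) (hX : IsConstructible S X) : FreeStarAlgebra (CStarGen S) :=
  gen (CStarGen.e X hX)

variable (S)

/-- The defining relations of the full semigroup C*-algebra `C*(S)`: the `v_s` are isometries with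
`v_{st} = v_s v_t`, the `e_X` are projections, `v_s e_X v_s^* = e_{sX}`, `e_S = 1`, `e_∅ = 0` and
`e_{X ∩ Y} = e_X e_Y`. -/
inductive SemigroupRel : FreeStarAlgebra (CStarGen S) → FreeStarAlgebra (CStarGen S) → Prop
  | isometry (s : S) : SemigroupRel (star (genV s) * genV s) 1
  | mul (s t : S) : SemigroupRel (genV (s * t)) (genV s * genV t)
  | selfAdjoint (X : Set S) (hX : IsConstructible S X) :
      SemigroupRel (star (genE X hX)) (genE X hX)
  | idempotent (X : Set S) (hX : IsConstructible S X) :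
      SemigroupRel (genE X hX * genE X hX) (genE X hX)
  | conj (s : S) (X : Set S) (hX : IsConstructible S X) :
      SemigroupRel (genV s * genE X hX * star (genV s)) (genE _ (hX.image s))
  | univ : SemigroupRel (genE Set.univ IsConstructible.univ) 1
  | empty : SemigroupRel (genE ∅ IsConstructible.empty) 0
  | inter (X Y : Set S) (hX : IsConstructible S X) (hY : IsConstructible S Y) :
      SemigroupRel (genE (X ∩ Y) (hX.inter hY)) (genE X hX * genE Y hY)

/-- The defining relations of the boundary quotient `Q(S)`: those of `C*(S)` together with
`∏_{f ∈ F} (1 - e_{fS}) = 0` for every foundation set `F` (listed in any order; the projections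
`e_{fS}` commute in `C*(S)`). -/
inductive BoundaryRel : FreeStarAlgebra (CStarGen S) → FreeStarAlgebra (CStarGen S) → Prop
  | of_semigroup (a b : FreeStarAlgebra (CStarGen S)) : SemigroupRel S a b → BoundaryRel a b
  | boundary (F : List S) (hF : IsFoundationSet {f | f ∈ F}) :
      BoundaryRel
        (F.map fun f => 1 - genE (principalRightIdeal f) (IsConstructible.principal S f)).prod 0

/-- The full semigroup C*-algebra `C*(S)`, the universal C*-algebra for `SemigroupRel`. The
relations force isometries and projections, which are automatically contractive. -/
abbrev SemigroupCStar : Type u := UniversalCStar (SemigroupRel S)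

/-- The boundary quotient `Q(S)` of `C*(S)`. -/
abbrev BoundaryQuotient : Type u := UniversalCStar (BoundaryRel S)

/-- The canonical `*`-homomorphism `C*(S) → Q(S)`, which maps generators to generators. -/
def boundaryQuotientMap : SemigroupCStar S →⋆ₐ[ℂ] BoundaryQuotient S :=
  UniversalCStar.mapOfImp BoundaryRel.of_semigroup

end SemigroupCStar

end

/-!
Foundation sets of the graph product `S_Γ` are controlled by an action of `S_Γ` on reduced words.

A reduced word, up to exchanging neighbouring letters at adjacent vertices, is encoded by its
subwords at all pairs of non-adjacent vertices (`GraphProduct.NormalHeap`); exchanges of letters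
then become equalities of encodings. Splitting off the letter at `v` in front (`GraphProduct.join`)
makes each `S_v` act, the actions at adjacent vertices commute, and so `S_Γ` acts. What is used of
this action is how the letter `head v σ` in front of `σ` behaves: `head v (p • σ) = p * head v σ`
for `p ∈ S_v`, `head v (q • σ) = head v σ` for `q ∈ S_w` with `w` adjacent to `v`, and two vertices
with a nontrivial letter in front are adjacent.

Represent `f ∈ S_Γ`, up to a unit on the right, by a word of minimal length
(`GraphProduct.IsTight`). A letter of such a word that can be moved to its end is not invertible, so
nothing that is multiplied on from the right cancels it. Hence the first letter of the word stays in
front in every right multiple of `f`, and it stays unchanged unless it commutes with the rest of the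
word (`GraphProduct.IsTight.head_eq_or_adj`). On the other hand, since the complement of `Γ` is
connected, there is a word that starts with a given letter `g ∈ S_u`, runs through any finite set of
vertices along non-adjacent ones, and ends in a non-invertible letter. It does not cancel either:
all its right multiples have exactly `g` in front, and no letter at another vertex of the finite set
(`GraphProduct.exists_head_eq`). Testing a foundation set without units on this word shows that, up
to units, it contains a letter of `S_u`, as soon as `g` is not a first letter of its tight words
(`GraphProduct.exists_tightWord_eq_singleton`).

For infinite `Γ`, a vertex `u` that does not occur in the tight words gives a contradiction. Then
every boundary relation has a factor `1 - e_{xS} = 0` with `x` invertible and holds already in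
`C*(S_Γ)`. If `u` and `v` are adjacent and `S_u`, `S_v` are infinite, then a foundation set without
units contains, up to units, a letter of `S_u` and a letter of `S_v`. These commute, so they are not
orthogonal. They are distinct elements of the foundation set, because the projection to `S_u` sends
the second one to a unit but not the first one; so the foundation set is not accurate.
-/

namespace GraphProduct

/-! ### Normal heaps and the action of a graph product on them -/

section Heaps

variable {V : Type*} (Γ : SimpleGraph V) (S : V → Type*)

/-- A family of lists of letters indexed by pairs of vertices. A word, up to exchanging neighbouring
letters at adjacent vertices, is encoded by its subwords of letters at `a` and `b`, one for each
pair `a`, `b` of non-adjacent (possibly equal) vertices. The lists at adjacent pairs play no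
role. -/
abbrev Heap : Type _ := V → V → List (Σ v, S v)

variable {S}

open Classical in
/-- Put the letter `x` at the vertex `v` in front of a heap. -/
noncomputable def push (v : V) (x : S v) (σ : Heap S) : Heap S := fun a b =>
  if ¬ Γ.Adj a b ∧ (a = v ∨ b = v) then ⟨v, x⟩ :: σ a b else σ a b

variable {Γ}

theorem push_comm {v w : V} (h : Γ.Adj v w) (x : S v) (y : S w) (σ : Heap S) :
    push Γ v x (push Γ w y σ) = push Γ w y (push Γ v x σ) := by
  have hne := h.ne
  have h' := h.symm
  funext a b
  unfold push
  split_ifs <;> grind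

theorem push_inj {v : V} {x y : S v} {σ τ : Heap S} (h : push Γ v x σ = push Γ v y τ) :
    x = y ∧ σ = τ := by
  constructor
  · have := congrFun (congrFun h v) v
    simp only [push, SimpleGraph.irrefl, not_false_eq_true, true_or, and_self, if_true,
      List.cons.injEq, Sigma.mk.injEq, heq_eq_eq, true_and] at this
    exact this.1
  · funext a b
    have := congrFun (congrFun h a) b
    unfold push at this
    split_ifs at this
    · exact (List.cons.inj this).2
    · exact this

open Classical in
/-- If letters at two different vertices are both in front of a heap, then the vertices are adjacent
and both letters can be taken off, in either order. -/
theorem exists_of_push_eq_push {v w : V} (hne : v ≠ w) {x : S v} {y : S w} {σ τ : Heap S}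
    (h : push Γ v x σ = push Γ w y τ) :
    Γ.Adj v w ∧ ∃ ρ, τ = push Γ v x ρ ∧ σ = push Γ w y ρ := by
  have hadj : Γ.Adj v w := by
    by_contra hvw
    have := congrFun (congrFun h v) w
    simp only [push, hvw, not_false_eq_true, true_or, or_true, and_self, if_true,
      List.cons.injEq, Sigma.mk.injEq] at this
    exact hne this.1.1
  have hadj' := hadj.symm
  have hp : ∀ a b, push Γ v x σ a b = push Γ w y τ a b := fun a b => by rw [h]
  refine ⟨hadj, fun a b => if ¬ Γ.Adj a b ∧ (a = v ∨ b = v) then σ a b else τ a b, ?_, ?_⟩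
  · funext a b
    have := hp a b
    unfold push at this ⊢
    split_ifs at this ⊢ <;> grind
  · funext a b
    have := hp a b
    unfold push at this ⊢
    split_ifs at this ⊢ <;> grind

variable (Γ) in
/-- No letter at `v` is in front of the heap. -/
def HeadFree (v : V) (σ : Heap S) : Prop := ∀ (x : S v) (τ : Heap S), σ ≠ push Γ v x τ

theorem headFree_nil (v : V) : HeadFree Γ v (fun _ _ => [] : Heap S) := fun x τ h => by
  have := congrFun (congrFun h v) v
  simp [push] at this

theorem headFree_push {v w : V} (hne : v ≠ w) {y : S w} {τ : Heap S} (h : HeadFree Γ v τ) :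
    HeadFree Γ v (push Γ w y τ) := fun x σ hσ => by
  obtain ⟨-, ρ, hρ, -⟩ := exists_of_push_eq_push hne hσ.symm
  exact h x ρ hρ

theorem HeadFree.of_push {v w : V} (hadj : Γ.Adj v w) {y : S w} {τ : Heap S}
    (h : HeadFree Γ v (push Γ w y τ)) : HeadFree Γ v τ := fun x σ hσ =>
  h x (push Γ w y σ) (by rw [hσ, push_comm hadj])

variable [∀ v, Monoid (S v)]

variable (Γ) in
/-- The heaps of reduced words: no letter is trivial, and no letter is put in front of a heap that
already has a letter at the same vertex in front. -/
inductive IsNormal : Heap S → Prop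
  | nil : IsNormal (fun _ _ => [])
  | push {v : V} {x : S v} {σ : Heap S} (hx : x ≠ 1) (hσ : IsNormal σ) (hv : HeadFree Γ v σ) :
      IsNormal (push Γ v x σ)

/-- The normality conditions hold for every letter in front of a normal heap, not only for the one
that was put there last. -/
theorem IsNormal.of_push {v : V} {x : S v} {σ : Heap S}
    (h : IsNormal Γ (GraphProduct.push Γ v x σ)) :
    x ≠ 1 ∧ IsNormal Γ σ ∧ HeadFree Γ v σ := by
  generalize hτ : GraphProduct.push Γ v x σ = τ at h
  induction h generalizing v x σ with
  | nil => exact absurd hτ.symm (headFree_nil v x σ)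
  | @push w y τ hy hnτ hw ih =>
    by_cases hvw : v = w
    · subst hvw
      obtain ⟨rfl, rfl⟩ := push_inj hτ
      exact ⟨hy, hnτ, hw⟩
    · obtain ⟨hadj, ρ, rfl, rfl⟩ := exists_of_push_eq_push hvw hτ
      obtain ⟨hx, hρ, hv⟩ := ih rfl
      exact ⟨hx, .push hy hρ (hw.of_push hadj.symm), headFree_push hvw hv⟩

open Classical in
variable (Γ) in
/-- Put a letter in front of a heap unless it is trivial. -/
noncomputable def glue (v : V) (x : S v) (τ : Heap S) : Heap S := if x = 1 then τ else push Γ v x τ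

theorem glue_one (v : V) (τ : Heap S) : glue Γ v 1 τ = τ := if_pos rfl

theorem glue_of_ne {v : V} {x : S v} (hx : x ≠ 1) (τ : Heap S) : glue Γ v x τ = push Γ v x τ :=
  if_neg hx

theorem glue_comm {v w : V} (h : Γ.Adj v w) (x : S v) (y : S w) (σ : Heap S) :
    glue Γ v x (glue Γ w y σ) = glue Γ w y (glue Γ v x σ) := by
  unfold glue
  split_ifs <;> first | rfl | exact push_comm h x y σ

theorem headFree_glue {v w : V} (hne : v ≠ w) (y : S w) {τ : Heap S} (h : HeadFree Γ v τ) :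
    HeadFree Γ v (glue Γ w y τ) := by
  unfold glue
  split_ifs
  exacts [h, headFree_push hne h]

theorem HeadFree.of_glue {v w : V} (hadj : Γ.Adj v w) {y : S w} {τ : Heap S}
    (h : HeadFree Γ v (glue Γ w y τ)) : HeadFree Γ v τ := by
  unfold glue at h
  split_ifs at h
  exacts [h, h.of_push hadj]

theorem isNormal_glue {v : V} (x : S v) {τ : Heap S} (hτ : IsNormal Γ τ) (hv : HeadFree Γ v τ) :
    IsNormal Γ (glue Γ v x τ) := by
  unfold glue
  split_ifs with h
  exacts [hτ, .push h hτ hv]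

theorem glue_inj {v : V} {x y : S v} {σ τ : Heap S} (hσ : HeadFree Γ v σ) (hτ : HeadFree Γ v τ)
    (h : glue Γ v x σ = glue Γ v y τ) : x = y ∧ σ = τ := by
  unfold glue at h
  split_ifs at h with h1 h2 h2
  · exact ⟨h1.trans h2.symm, h⟩
  · exact absurd h (hσ _ _)
  · exact absurd h.symm (hτ _ _)
  · exact push_inj h

theorem IsNormal.exists_glue (v : V) {σ : Heap S} (hσ : IsNormal Γ σ) :
    ∃ (x : S v) (τ : Heap S), IsNormal Γ τ ∧ HeadFree Γ v τ ∧ glue Γ v x τ = σ := by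
  by_cases h : HeadFree Γ v σ
  · exact ⟨1, σ, hσ, h, glue_one v σ⟩
  · unfold HeadFree at h
    push Not at h
    obtain ⟨x, τ, rfl⟩ := h
    obtain ⟨hx, hτ, hv⟩ := hσ.of_push
    exact ⟨x, τ, hτ, hv, glue_of_ne hx τ⟩

variable (Γ S) in
/-- The normal heaps. They stand for the elements of the graph product, in reduced form. -/
abbrev NormalHeap : Type _ := {σ : Heap S // IsNormal Γ σ}

variable (Γ S) in
/-- The normal heaps without a letter at `v` in front. -/
abbrev NormalHeadFree (v : V) : Type _ := {τ : Heap S // IsNormal Γ τ ∧ HeadFree Γ v τ}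

variable (Γ S) in
/-- A normal heap is the same as an element of `S v`, namely its letter at `v` in front (or `1`),
together with a normal heap that has no letter at `v` in front. -/
noncomputable def join (v : V) : S v × NormalHeadFree Γ S v ≃ NormalHeap Γ S :=
  Equiv.ofBijective (fun p => ⟨glue Γ v p.1 p.2.1, isNormal_glue p.1 p.2.2.1 p.2.2.2⟩) <| by
    constructor
    · rintro ⟨x, σ, _, hσ⟩ ⟨y, τ, _, hτ⟩ h
      obtain ⟨rfl, rfl⟩ := glue_inj hσ hτ (Subtype.ext_iff.1 h)
      rfl
    · rintro ⟨σ, hσ⟩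
      obtain ⟨x, τ, hτ, hv, rfl⟩ := hσ.exists_glue v
      exact ⟨(x, ⟨τ, hτ, hv⟩), rfl⟩

/-- The letter at `v` in front of a normal heap, or `1` if there is none. -/
noncomputable def head (v : V) (σ : NormalHeap Γ S) : S v := ((join Γ S v).symm σ).1

theorem head_eq {v : V} {x : S v} {τ : Heap S} {σ : NormalHeap Γ S} (hτ : IsNormal Γ τ)
    (hv : HeadFree Γ v τ) (h : σ.1 = glue Γ v x τ) : head v σ = x := by
  have : σ = join Γ S v (x, ⟨τ, hτ, hv⟩) := Subtype.ext h
  rw [this, head, Equiv.symm_apply_apply]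

/-- The action of a vertex monoid on the normal heaps, by left multiplication of the letter in
front. -/
noncomputable def vertexAction (v : V) : S v →* Function.End (NormalHeap Γ S) where
  toFun p := fun σ => join Γ S v (p * head v σ, ((join Γ S v).symm σ).2)
  map_one' := by
    funext σ
    rw [one_mul]
    exact (join Γ S v).apply_symm_apply σ
  map_mul' p q := by
    funext σ
    show _ = join Γ S v (p * head v (join Γ S v _), ((join Γ S v).symm (join Γ S v _)).2)
    simp only [head, Equiv.symm_apply_apply, mul_assoc]

theorem vertexAction_eq {v : V} {x : S v} {τ : Heap S} {σ : NormalHeap Γ S} (p : S v)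
    (hτ : IsNormal Γ τ) (hv : HeadFree Γ v τ) (h : σ.1 = glue Γ v x τ) :
    (vertexAction v p σ).1 = glue Γ v (p * x) τ := by
  have : σ = join Γ S v (x, ⟨τ, hτ, hv⟩) := Subtype.ext h
  show (join Γ S v (p * head v σ, ((join Γ S v).symm σ).2)).1 = _
  rw [head_eq hτ hv h, this, Equiv.symm_apply_apply]
  rfl

theorem head_vertexAction (v : V) (p : S v) (σ : NormalHeap Γ S) :
    head v (vertexAction v p σ) = p * head v σ := by
  show head v (join Γ S v _) = _
  rw [head, Equiv.symm_apply_apply]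

/-- The letters in front of a normal heap at two adjacent vertices can be taken off
simultaneously. -/
theorem exists_glue_glue {v w : V} (h : Γ.Adj v w) (σ : NormalHeap Γ S) :
    ∃ (x : S v) (y : S w) (ρ : Heap S), IsNormal Γ ρ ∧ HeadFree Γ v ρ ∧ HeadFree Γ w ρ ∧
      σ.1 = glue Γ v x (glue Γ w y ρ) := by
  obtain ⟨x, τ, hτ, hv, hσ⟩ := σ.2.exists_glue v
  obtain ⟨y, ρ, hρ, hw, rfl⟩ := hτ.exists_glue w
  exact ⟨x, y, ρ, hρ, hv.of_glue h, hw, hσ.symm⟩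

theorem head_vertexAction_of_adj {v w : V} (h : Γ.Adj v w) (q : S w) (σ : NormalHeap Γ S) :
    head v (vertexAction w q σ) = head v σ := by
  obtain ⟨x, y, ρ, hρ, hv, hw, hσ⟩ := exists_glue_glue h σ
  rw [head_eq (isNormal_glue y hρ hw) (headFree_glue h.ne y hv) hσ]
  rw [glue_comm h] at hσ
  refine head_eq (isNormal_glue (q * y) hρ hw) (headFree_glue h.ne _ hv) ?_
  rw [vertexAction_eq q (isNormal_glue x hρ hv) (headFree_glue h.ne' x hw) hσ, glue_comm h]

theorem vertexAction_comm {v w : V} (h : Γ.Adj v w) (p : S v) (q : S w) :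
    (vertexAction v p * vertexAction w q : Function.End (NormalHeap Γ S)) =
      vertexAction w q * vertexAction v p := by
  funext σ
  obtain ⟨x, y, ρ, hρ, hv, hw, hσ⟩ := exists_glue_glue h σ
  have hσ' := hσ.trans (glue_comm h x y ρ)
  have h1 := vertexAction_eq p (isNormal_glue y hρ hw) (headFree_glue h.ne y hv) hσ
  have h2 := vertexAction_eq q (isNormal_glue x hρ hv) (headFree_glue h.ne' x hw) hσ'
  rw [glue_comm h] at h1
  rw [← glue_comm h] at h2
  refine Subtype.ext ?_
  show (vertexAction v p (vertexAction w q σ)).1 = (vertexAction w q (vertexAction v p σ)).1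
  rw [vertexAction_eq p (isNormal_glue (q * y) hρ hw) (headFree_glue h.ne _ hv) h2,
    vertexAction_eq q (isNormal_glue (p * x) hρ hv) (headFree_glue h.ne' _ hw) h1, glue_comm h]

theorem adj_of_head_ne_one {v w : V} (hne : v ≠ w) {σ : NormalHeap Γ S} (hv : head v σ ≠ 1)
    (hw : head w σ ≠ 1) : Γ.Adj v w := by
  obtain ⟨x, τ, hτ, hfv, hσ⟩ := σ.2.exists_glue v
  obtain ⟨y, ρ, hρ, hfw, hσ'⟩ := σ.2.exists_glue w
  rw [head_eq hτ hfv hσ.symm] at hv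
  rw [head_eq hρ hfw hσ'.symm] at hw
  rw [glue_of_ne hv] at hσ
  rw [glue_of_ne hw] at hσ'
  exact (exists_of_push_eq_push hne (hσ.trans hσ'.symm)).1

end Heaps

/-! ### Generators, words and tight words -/

section Words

variable {V : Type*} {Γ : SimpleGraph V} {S : V → Type*} [∀ v, Monoid (S v)]

variable (Γ) in
/-- The canonical homomorphism from a vertex monoid to the graph product. -/
def of (v : V) : S v →* GraphProduct Γ S :=
  (conGen (GraphProductRel Γ S)).mk'.comp Monoid.CoprodI.of

theorem of_comm {v w : V} (h : Γ.Adj v w) (x : S v) (y : S w) :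
    of Γ v x * of Γ w y = of Γ w y * of Γ v x :=
  (Con.eq _).2 (ConGen.Rel.of _ _ (.comm h x y))

/-- The homomorphism from the graph product given by homomorphisms from the vertex monoids whose
images at adjacent vertices commute. -/
def lift {M : Type*} [Monoid M] (f : ∀ v, S v →* M)
    (hf : ∀ v w, Γ.Adj v w → ∀ x y, f v x * f w y = f w y * f v x) : GraphProduct Γ S →* M :=
  (conGen (GraphProductRel Γ S)).lift (Monoid.CoprodI.lift f) <| Con.conGen_le.2 <| by
    rintro _ _ ⟨h, x, y⟩
    simpa [Con.ker_rel] using hf _ _ h x y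

theorem lift_of {M : Type*} [Monoid M] (f : ∀ v, S v →* M)
    (hf : ∀ v w, Γ.Adj v w → ∀ x y, f v x * f w y = f w y * f v x) (v : V) (x : S v) :
    lift f hf (of Γ v x) = f v x :=
  Monoid.CoprodI.lift_of f x

variable (Γ S) in
/-- The action of the graph product on the normal heaps, as a homomorphism. -/
noncomputable def action : GraphProduct Γ S →* Function.End (NormalHeap Γ S) :=
  lift vertexAction fun _ _ h => vertexAction_comm h

noncomputable instance : MulAction (GraphProduct Γ S) (NormalHeap Γ S) :=
  MulAction.compHom _ (action Γ S)

theorem of_smul (v : V) (x : S v) (σ : NormalHeap Γ S) : of Γ v x • σ = vertexAction v x σ := by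
  show action Γ S (of Γ v x) σ = _
  rw [action, lift_of]

theorem head_of_smul (v : V) (p : S v) (σ : NormalHeap Γ S) :
    head v (of Γ v p • σ) = p * head v σ := by
  rw [of_smul, head_vertexAction]

theorem head_of_smul_of_adj {v w : V} (h : Γ.Adj v w) (q : S w) (σ : NormalHeap Γ S) :
    head v (of Γ w q • σ) = head v σ := by
  rw [of_smul, head_vertexAction_of_adj h]

variable (Γ) in
/-- The element of the graph product that a word represents. -/
def wordProd (l : List (Σ v, S v)) : GraphProduct Γ S := (l.map fun a => of Γ a.1 a.2).prod

theorem wordProd_cons (v : V) (x : S v) (l : List (Σ v, S v)) :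
    wordProd Γ (⟨v, x⟩ :: l) = of Γ v x * wordProd Γ l := by simp [wordProd]

theorem exists_wordProd (x : GraphProduct Γ S) : ∃ l, wordProd Γ l = x := by
  obtain ⟨y, rfl⟩ := Con.mk'_surjective x
  induction y using Monoid.CoprodI.induction_left with
  | one => exact ⟨[], (map_one _).symm⟩
  | mul m y ih =>
    obtain ⟨l, hl⟩ := ih
    exact ⟨⟨_, m⟩ :: l, by rw [wordProd_cons, hl, map_mul]; rfl⟩

theorem of_comm_wordProd {v : V} (x : S v) {l : List (Σ v, S v)} (h : ∀ a ∈ l, Γ.Adj v a.1) :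
    of Γ v x * wordProd Γ l = wordProd Γ l * of Γ v x := by
  induction l with
  | nil => simp [wordProd]
  | cons a l ih =>
    obtain ⟨w, y⟩ := a
    rw [wordProd_cons, ← mul_assoc, of_comm (h _ List.mem_cons_self), mul_assoc,
      ih fun a ha => h a (List.mem_cons_of_mem _ ha), mul_assoc]

variable (Γ) in
/-- A word is tight if no shorter word represents the same element up to an invertible factor on
the right. -/
def IsTight (l : List (Σ v, S v)) : Prop :=
  ∀ l' (h : GraphProduct Γ S), IsUnit h → wordProd Γ l = wordProd Γ l' * h → l.length ≤ l'.length

theorem exists_isTight (x : GraphProduct Γ S) :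
    ∃ l h, IsTight Γ l ∧ IsUnit h ∧ x = wordProd Γ l * h := by
  classical
  have hex : ∃ n, ∃ l, ∃ h : GraphProduct Γ S, IsUnit h ∧ x = wordProd Γ l * h ∧ l.length = n := by
    obtain ⟨l, hl⟩ := exists_wordProd x
    exact ⟨_, l, 1, isUnit_one, by rw [hl, mul_one], rfl⟩
  obtain ⟨l, h, hh, hx, hn⟩ := Nat.find_spec hex
  refine ⟨l, h, fun l' h' hh' hl => ?_, hh, hx⟩
  rw [hn]
  exact Nat.find_min' hex ⟨l', h' * h, hh'.mul hh, by rw [hx, hl, mul_assoc], rfl⟩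

theorem IsTight.of_eq {l l' : List (Σ v, S v)} (h : IsTight Γ l)
    (he : wordProd Γ l = wordProd Γ l') (hlen : l'.length ≤ l.length) : IsTight Γ l' :=
  fun m u hu hm => hlen.trans (h m u hu (he.trans hm))

theorem IsTight.tail {v : V} {x : S v} {l : List (Σ v, S v)} (h : IsTight Γ (⟨v, x⟩ :: l)) :
    IsTight Γ l := fun m u hu hm => by
  have := h (⟨v, x⟩ :: m) u hu (by rw [wordProd_cons, wordProd_cons, hm, mul_assoc])
  simpa using this

theorem IsTight.ne_one {v : V} {x : S v} {l : List (Σ v, S v)} (h : IsTight Γ (⟨v, x⟩ :: l)) :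
    x ≠ 1 := by
  rintro rfl
  have := h l 1 isUnit_one (by rw [wordProd_cons, map_one, one_mul, mul_one])
  simp at this

variable (Γ) in
/-- The word can be rewritten, without becoming longer, to start with a letter at `v`. -/
def StartsAt (v : V) (l : List (Σ v, S v)) : Prop :=
  ∃ (y : S v) (l' : List (Σ v, S v)), wordProd Γ l = of Γ v y * wordProd Γ l' ∧
    l'.length < l.length

/-- Letters at the same vertex at the beginning of a tight word have been multiplied together. -/
theorem IsTight.not_startsAt {v : V} {x : S v} {l : List (Σ v, S v)}
    (h : IsTight Γ (⟨v, x⟩ :: l)) : ¬ StartsAt Γ v l := by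
  rintro ⟨y, l', hl, hlen⟩
  have := h (⟨v, x * y⟩ :: l') 1 isUnit_one (by
    rw [mul_one, wordProd_cons, wordProd_cons, hl, map_mul, mul_assoc])
  simp only [List.length_cons] at this
  omega

/-- A letter of a tight word that can be moved to its end is not invertible. -/
theorem IsTight.not_isUnit {v : V} {x : S v} {l : List (Σ v, S v)}
    (h : IsTight Γ (⟨v, x⟩ :: l)) (hl : ∀ a ∈ l, Γ.Adj v a.1) : ¬ IsUnit x := fun hx => by
  have := h l (of Γ v x) (hx.map _) (by rw [wordProd_cons, of_comm_wordProd x hl])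
  simp at this

end Words

/-! ### Heads of translates of a heap -/

section Heads

variable {V : Type*} {Γ : SimpleGraph V} {S : V → Type*} [∀ v, Monoid (S v)]

theorem _root_.IsRightLCM.isUnit_of_mul_eq_one {M : Type*} [Monoid M] (hM : IsRightLCM M) {x y : M}
    (h : x * y = 1) : IsUnit x :=
  ⟨⟨x, y, h, hM.left_cancel x _ _ (by rw [← mul_assoc, h, one_mul, mul_one])⟩, rfl⟩

/-- A letter in front of the translate of a heap by a tight word comes from the word, unless it
comes from the heap and commutes with the whole word. -/
theorem IsTight.startsAt_or_adj (hS : ∀ v, IsRightLCM (S v)) {l : List (Σ v, S v)}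
    (hl : IsTight Γ l) {v : V} {σ : NormalHeap Γ S} (hv : head v (wordProd Γ l • σ) ≠ 1) :
    StartsAt Γ v l ∨ ∀ a ∈ l, Γ.Adj v a.1 := by
  induction l generalizing v with
  | nil => exact .inr (by simp)
  | cons a l ih =>
    obtain ⟨w, x⟩ := a
    by_cases hvw : v = w
    · subst hvw
      exact .inl ⟨x, l, wordProd_cons v x l, by simp⟩
    rw [wordProd_cons, mul_smul] at hv
    by_cases hadj : Γ.Adj v w
    · rw [head_of_smul_of_adj hadj] at hv
      rcases ih hl.tail hv with ⟨y, l', hy, hlen⟩ | hall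
      · refine .inl ⟨y, ⟨w, x⟩ :: l', ?_, by simpa using hlen⟩
        rw [wordProd_cons, wordProd_cons, hy, ← mul_assoc, ← of_comm hadj, mul_assoc]
      · exact .inr (by simpa [hadj] using hall)
    · -- The letter `x` must then have been cancelled by a letter in front of the rest.
      exfalso
      have h1 : head w (of Γ w x • wordProd Γ l • σ) = 1 := by
        by_contra hw
        exact hadj (adj_of_head_ne_one hvw hv hw)
      rw [head_of_smul] at h1
      have h2 : head w (wordProd Γ l • σ) ≠ 1 := fun h => hl.ne_one (by rwa [h, mul_one] at h1)
      rcases ih hl.tail h2 with h | h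
      · exact hl.not_startsAt h
      · exact hl.not_isUnit h ((hS w).isUnit_of_mul_eq_one h1)

/-- The first letter of a tight word is in front of each translate by the word, possibly multiplied
by another letter if it commutes with the rest of the word. -/
theorem IsTight.head_eq_or_adj (hS : ∀ v, IsRightLCM (S v)) {v : V} {x : S v}
    {l : List (Σ v, S v)} (hl : IsTight Γ (⟨v, x⟩ :: l)) (σ : NormalHeap Γ S) :
    head v (wordProd Γ (⟨v, x⟩ :: l) • σ) ≠ 1 ∧
      (head v (wordProd Γ (⟨v, x⟩ :: l) • σ) = x ∨ ∀ a ∈ l, Γ.Adj v a.1) := by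
  rw [wordProd_cons, mul_smul, head_of_smul]
  by_cases h : head v (wordProd Γ l • σ) = 1
  · rw [h, mul_one]
    exact ⟨hl.ne_one, .inl rfl⟩
  · have hall := (hl.tail.startsAt_or_adj hS h).resolve_left hl.not_startsAt
    exact ⟨fun h1 => hl.not_isUnit hall ((hS v).isUnit_of_mul_eq_one h1), .inr hall⟩

/-- Connectedness of the complement graph, as an induction principle. -/
theorem _root_.IsCoconnected.induction (hΓ : IsCoconnected Γ) {P : V → Prop} {v : V} (hv : P v)
    (h : ∀ u w, u ≠ w → ¬ Γ.Adj u w → P w → P u) (u : V) : P u := by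
  by_contra hu
  refine hΓ ⟨{w | P w}, ⟨v, hv⟩, ⟨u, hu⟩, fun w hw z hz => ?_⟩
  by_contra hwz
  have hw : P w := hw
  have hz : ¬ P z := hz
  exact hz (h z w (by rintro rfl; exact hz hw) (fun h' => hwz h'.symm) hw)

theorem _root_.IsCoconnected.exists_not_adj [Nontrivial V] (hΓ : IsCoconnected Γ) (u : V) :
    ∃ w, u ≠ w ∧ ¬ Γ.Adj u w := by
  by_contra! h
  obtain ⟨w, hw⟩ := exists_ne u
  exact hΓ ⟨{u}, ⟨u, rfl⟩, ⟨w, hw⟩, by rintro _ rfl z hz; exact h _ (Ne.symm hz)⟩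

variable (Γ S) in
/-- There is an element all of whose right multiples have a letter at `u` in front and none at any
other vertex in `A`. -/
def HasWalk (u : V) (A : Set V) : Prop :=
  ∃ s : GraphProduct Γ S, ∀ σ : NormalHeap Γ S,
    head u (s • σ) ≠ 1 ∧ ∀ v, v ≠ u → head v (s • σ) ≠ 1 → v ∉ A

/-- Put a letter at a vertex `u` in front of a walk that starts at a vertex not adjacent to `u`. -/
theorem exists_head_eq {u w : V} (hne : u ≠ w) (hadj : ¬ Γ.Adj u w) {A : Set V}
    (hw : HasWalk Γ S w A) {g : S u} (hg : g ≠ 1) :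
    ∃ s : GraphProduct Γ S, ∀ σ : NormalHeap Γ S,
      head u (s • σ) = g ∧ ∀ v, v ≠ u → head v (s • σ) ≠ 1 → v ∉ insert w A := by
  obtain ⟨s, hs⟩ := hw
  refine ⟨of Γ u g * s, fun σ => ?_⟩
  have hu : head u ((of Γ u g * s) • σ) = g := by
    have : head u (s • σ) = 1 := by
      by_contra h
      exact hadj (adj_of_head_ne_one hne h (hs σ).1)
    rw [mul_smul, head_of_smul, this, mul_one]
  refine ⟨hu, fun v hvu hv => ?_⟩
  have hvadj : Γ.Adj v u := adj_of_head_ne_one hvu hv (by rwa [hu])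
  rw [mul_smul, head_of_smul_of_adj hvadj] at hv
  have hvw : v ≠ w := by
    rintro rfl
    exact hadj hvadj.symm
  rintro (h | h)
  exacts [hvw h, (hs σ).2 v hvw hv h]

/-- The complement graph being connected, a walk in it can start anywhere, visit every vertex of a
given finite set and end at a given vertex. If its last letter is not invertible, it does not
cancel. -/
theorem hasWalk (hS : ∀ v, IsRightLCM (S v)) [∀ v, Nontrivial (S v)] (hΓ : IsCoconnected Γ)
    {v₀ : V} {x₀ : S v₀} (hx₀ : ¬ IsUnit x₀) {A : Set V} (hA : A.Finite) (u : V) :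
    HasWalk Γ S u A := by
  have extend : ∀ {A : Set V} {w}, HasWalk Γ S w A → ∀ u, HasWalk Γ S u A := fun {A _} hw u =>
    hΓ.induction (P := fun u => HasWalk Γ S u A) hw (fun u w hne hadj hw => by
      obtain ⟨g, hg⟩ := exists_ne (1 : S u)
      obtain ⟨s, hs⟩ := exists_head_eq hne hadj hw hg
      exact ⟨s, fun σ => ⟨by rwa [(hs σ).1], fun v hvu hv hvA =>
        (hs σ).2 v hvu hv (Set.mem_insert_of_mem _ hvA)⟩⟩) u
  induction A, hA using Set.Finite.induction_on generalizing u with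
  | empty =>
    refine extend (w := v₀) ⟨of Γ v₀ x₀, fun σ => ⟨fun h => hx₀ ?_, fun _ _ _ => by simp⟩⟩ u
    rw [head_of_smul] at h
    exact (hS v₀).isUnit_of_mul_eq_one h
  | @insert a A _ _ ih =>
    obtain ⟨s, hs⟩ := ih a
    exact extend (w := a) ⟨s, fun σ => ⟨(hs σ).1, fun v hva hv hvA =>
      hvA.elim hva ((hs σ).2 v hva hv)⟩⟩ u

end Heads

end GraphProduct

/-! ### Foundation sets and units -/

section FoundationSets

variable {M : Type*} [Monoid M]

theorem not_orthogonal_iff {s t : M} : ¬ Orthogonal s t ↔ ∃ a b, s * a = t * b := by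
  rw [Orthogonal, ← Ne, ← Set.nonempty_iff_ne_empty]
  constructor
  · rintro ⟨x, ⟨a, rfl⟩, b, hb⟩
    exact ⟨a, b, hb⟩
  · rintro ⟨a, b, h⟩
    exact ⟨s * a, ⟨a, rfl⟩, b, h⟩

theorem not_orthogonal_of_mul_eq_one {x t : M} (h : x * t = 1) (s : M) : ¬ Orthogonal x s :=
  not_orthogonal_iff.2 ⟨t * s, 1, by rw [← mul_assoc, h, one_mul, mul_one]⟩

theorem isFoundationSet_singleton {x t : M} (h : x * t = 1) : IsFoundationSet ({x} : Set M) :=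
  ⟨Set.finite_singleton x, fun s => ⟨x, rfl, not_orthogonal_of_mul_eq_one h s⟩⟩

theorem isAccurate_singleton (x : M) : IsAccurate ({x} : Set M) := by
  rintro _ rfl _ rfl h
  exact absurd rfl h

theorem IsAccurate.eq_singleton {F : Set M} (hF : IsAccurate F) {x : M} (hx : x ∈ F)
    (hu : IsUnit x) : F = {x} := by
  obtain ⟨t, ht⟩ := hu.exists_right_inv
  refine Set.eq_singleton_iff_unique_mem.2 ⟨hx, fun y hy => ?_⟩
  by_contra hne
  exact not_orthogonal_of_mul_eq_one ht y (hF x hx y hy (Ne.symm hne))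

theorem hasAR_of_exists_isUnit (h : ∀ F : Set M, IsFoundationSet F → ∃ x ∈ F, IsUnit x) :
    HasAR M := fun F hF => by
  obtain ⟨x, hx, hu⟩ := h F hF
  obtain ⟨t, ht⟩ := hu.exists_right_inv
  exact ⟨{x}, isFoundationSet_singleton ht, isAccurate_singleton x,
    fun y hy => ⟨x, hx, 1, by rw [hy, mul_one]⟩⟩

end FoundationSets

/-! ### The boundary relations when every foundation set contains a unit -/

section Boundary

open FreeStarAlgebra UniversalCStar PreUniversalCStar

section MapOfImp

variable {G : Type*} {r r' : FreeStarAlgebra G → FreeStarAlgebra G → Prop}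

theorem UniversalCStar.eval_ι_eq_of_rel {a b : FreeStarAlgebra G} (h : r a b) :
    eval (ι : G → UniversalCStar r) a = eval ι b := by
  rw [eval_ι, eval_ι]
  exact coe_eq_of_rel h

theorem UniversalCStar.mapOfImp_coe (h : ∀ a b, r a b → r' a b) (a : FreeStarAlgebra G) :
    mapOfImp h (UniversalCStar.coe (toPre r a)) = UniversalCStar.coe (toPre r' a) :=
  (liftRingHom_coe ι norm_ι_le (fun a b hab => eval_ι_eq_of_rel (h a b hab)) (toPre r a)).trans
    (eval_ι a)

theorem UniversalCStar.continuous_mapOfImp (h : ∀ a b, r a b → r' a b) :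
    Continuous (mapOfImp h : UniversalCStar r → UniversalCStar r') :=
  continuous_liftRingHom ι norm_ι_le fun a b hab => eval_ι_eq_of_rel (h a b hab)

end MapOfImp

variable {M : Type*} [Monoid M]

theorem eval_genE_eq_one {X : Set M} (hX : IsConstructible M X) (h : X = Set.univ) :
    eval (ι : CStarGen M → SemigroupCStar M) (genE X hX) = 1 := by
  subst h
  rw [← map_one (eval ι)]
  exact eval_ι_eq_of_rel SemigroupRel.univ

/-- A boundary relation already holds in the full semigroup C*-algebra if one of its factors is
`1 - e_{xS}` with `x` invertible, because then `xS = S`. -/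
theorem eval_eq_of_boundaryRel (h : ∀ F : Set M, IsFoundationSet F → ∃ x ∈ F, IsUnit x)
    {a b : FreeStarAlgebra (CStarGen M)} (hab : BoundaryRel M a b) :
    eval (ι : CStarGen M → SemigroupCStar M) a = eval ι b := by
  cases hab with
  | of_semigroup _ _ hab => exact eval_ι_eq_of_rel hab
  | boundary F hF =>
    obtain ⟨x, hx, hu⟩ := h _ hF
    rw [map_list_prod, map_zero]
    refine List.prod_eq_zero (List.mem_map.2 ⟨_, List.mem_map.2 ⟨x, hx, rfl⟩, ?_⟩)
    obtain ⟨t, ht⟩ := hu.exists_right_inv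
    have : principalRightIdeal x = Set.univ :=
      Set.eq_univ_of_forall fun y => ⟨t * y, by rw [← mul_assoc, ht, one_mul]⟩
    rw [map_sub, map_one, eval_genE_eq_one _ this, sub_self]

theorem bijective_boundaryQuotientMap (h : ∀ F : Set M, IsFoundationSet F → ∃ x ∈ F, IsUnit x) :
    Function.Bijective (boundaryQuotientMap M) := by
  have hr : ∀ a b, BoundaryRel M a b →
      eval (ι : CStarGen M → SemigroupCStar M) a = eval ι b := fun a b => eval_eq_of_boundaryRel h
  let ψ : BoundaryQuotient M → SemigroupCStar M := liftRingHom ι norm_ι_le hr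
  have hψ : ∀ a, ψ (UniversalCStar.coe (toPre _ a)) = UniversalCStar.coe (toPre _ a) := fun a =>
    (liftRingHom_coe ι norm_ι_le hr (toPre _ a)).trans (eval_ι a)
  have hψc : Continuous ψ := continuous_liftRingHom ι norm_ι_le hr
  have hφc : Continuous (boundaryQuotientMap M) := continuous_mapOfImp _
  refine Function.bijective_iff_has_inverse.2 ⟨ψ, fun x => ?_, fun x => ?_⟩
  · induction x using UniversalCStar.induction with
    | closed => exact isClosed_eq (hψc.comp hφc) continuous_id
    | h a =>
      exact (congrArg ψ (mapOfImp_coe BoundaryRel.of_semigroup a)).trans (hψ a)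
  · induction x using UniversalCStar.induction with
    | closed => exact isClosed_eq (hφc.comp hψc) continuous_id
    | h a =>
      exact (congrArg (boundaryQuotientMap M) (hψ a)).trans
        (mapOfImp_coe BoundaryRel.of_semigroup a)

end Boundary

namespace GraphProduct

/-! ### Foundation sets of graph products -/

section Foundation

variable {V : Type*} {Γ : SimpleGraph V} {S : V → Type*} [∀ v, Monoid (S v)]

/-- A chosen tight word that represents an element up to an invertible factor on the right. -/
noncomputable def tightWord (x : GraphProduct Γ S) : List (Σ v, S v) := (exists_isTight x).choose

theorem isTight_tightWord (x : GraphProduct Γ S) : IsTight Γ (tightWord x) :=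
  (exists_isTight x).choose_spec.choose_spec.1

theorem exists_eq_wordProd_tightWord (x : GraphProduct Γ S) :
    ∃ h, IsUnit h ∧ x = wordProd Γ (tightWord x) * h :=
  ⟨_, (exists_isTight x).choose_spec.choose_spec.2⟩

theorem tightWord_ne_nil {x : GraphProduct Γ S} (hx : ¬ IsUnit x) : tightWord x ≠ [] := fun h => by
  obtain ⟨c, hc, he⟩ := exists_eq_wordProd_tightWord x
  rw [h, wordProd, List.map_nil, List.prod_nil, one_mul] at he
  exact hx (he ▸ hc)

theorem isUnit_wordProd {l : List (Σ v, S v)} (h : ∀ a ∈ l, IsUnit a.2) :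
    IsUnit (wordProd Γ l) := by
  induction l with
  | nil => exact isUnit_one
  | cons a l ih =>
    rw [wordProd_cons]
    exact ((h a List.mem_cons_self).map _).mul (ih fun b hb => h b (List.mem_cons_of_mem _ hb))

theorem exists_not_isUnit {x : GraphProduct Γ S} (hx : ¬ IsUnit x) :
    ∃ (v : V) (y : S v), ¬ IsUnit y := by
  by_contra! h
  obtain ⟨l, rfl⟩ := exists_wordProd x
  exact hx (isUnit_wordProd fun a _ => h a.1 a.2)

/-- The vertices that occur in the tight words of the elements of `F`. -/
def support (F : Set (GraphProduct Γ S)) : Set V := {v | ∃ f ∈ F, ∃ a ∈ tightWord f, a.1 = v}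

theorem finite_support {F : Set (GraphProduct Γ S)} (hF : F.Finite) : (support F).Finite := by
  have : support F = ⋃ f ∈ F, Sigma.fst '' {a | a ∈ tightWord f} := by
    ext v
    simp [support]
  rw [this]
  exact hF.biUnion fun f _ => (List.finite_toSet _).image _

/-- If all right multiples of `s` have `g`, and no letter at another vertex of `l`, in front, then a
tight word `l` that has a common right multiple with `s` either starts with `g` or is a single
letter. -/
theorem IsTight.eq_singleton (hS : ∀ v, IsRightLCM (S v)) {u : V} {g : S u}
    {s : GraphProduct Γ S} {l : List (Σ v, S v)} (hl : IsTight Γ l) (hne : l ≠ [])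
    (hs : ∀ σ : NormalHeap Γ S,
      head u (s • σ) = g ∧ ∀ v, v ≠ u → head v (s • σ) ≠ 1 → ∀ a ∈ l, a.1 ≠ v)
    (hg : ∀ l', l ≠ ⟨u, g⟩ :: l') {a b : GraphProduct Γ S} (hab : wordProd Γ l * a = s * b) :
    ∃ y : S u, l = [⟨u, y⟩] := by
  let σ : NormalHeap Γ S := ⟨_, .nil⟩
  have hab' : wordProd Γ l • a • σ = s • b • σ := by rw [smul_smul, hab, smul_smul]
  have hs := hs (b • σ)
  rw [← hab'] at hs
  obtain ⟨⟨v, y⟩, l', rfl⟩ := List.exists_cons_of_ne_nil hne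
  obtain ⟨h1, h2⟩ := hl.head_eq_or_adj hS (a • σ)
  obtain rfl : v = u := by
    by_contra hvu
    exact hs.2 v hvu h1 _ List.mem_cons_self rfl
  rw [hs.1] at h2
  rcases h2 with rfl | hadj
  · exact absurd rfl (hg l')
  rcases l' with _ | ⟨⟨w, z⟩, l'⟩
  · exact ⟨y, rfl⟩
  -- The second letter commutes with the first one, so it can be put in front as well.
  exfalso
  have hvw : Γ.Adj v w := hadj _ List.mem_cons_self
  have hswap : wordProd Γ (⟨v, y⟩ :: ⟨w, z⟩ :: l') = wordProd Γ (⟨w, z⟩ :: ⟨v, y⟩ :: l') := by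
    simp only [wordProd_cons, ← mul_assoc, of_comm hvw]
  have h3 := ((hl.of_eq hswap (by simp)).head_eq_or_adj hS (a • σ)).1
  rw [← hswap] at h3
  exact hs.2 w hvw.ne' h3 ⟨w, z⟩ (by simp) rfl

/-- A foundation set without units contains, up to units, a letter at the vertex `u`, provided that
some nontrivial letter at `u` is not a first letter of its tight words. -/
theorem exists_tightWord_eq_singleton (hS : ∀ v, IsRightLCM (S v)) [Nontrivial V]
    [∀ v, Nontrivial (S v)] (hΓ : IsCoconnected Γ) {F : Set (GraphProduct Γ S)}
    (hF : IsFoundationSet F) (hF' : ∀ f ∈ F, ¬ IsUnit f) {u : V} {g : S u} (hg : g ≠ 1)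
    (hgF : ∀ f ∈ F, ∀ l, tightWord f ≠ ⟨u, g⟩ :: l) :
    ∃ f ∈ F, ∃ y : S u, tightWord f = [⟨u, y⟩] := by
  obtain ⟨f₀, hf₀, -⟩ := hF.2 1
  obtain ⟨v₀, x₀, hx₀⟩ := exists_not_isUnit (hF' f₀ hf₀)
  obtain ⟨w, hne, hadj⟩ := hΓ.exists_not_adj u
  obtain ⟨s, hs⟩ := exists_head_eq hne hadj (hasWalk hS hΓ hx₀ (finite_support hF.1) w) hg
  obtain ⟨f, hf, hfs⟩ := hF.2 s
  obtain ⟨a, b, hab⟩ := not_orthogonal_iff.1 hfs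
  obtain ⟨c, -, hc⟩ := exists_eq_wordProd_tightWord f
  refine ⟨f, hf, (isTight_tightWord f).eq_singleton hS (tightWord_ne_nil (hF' f hf)) (s := s)
    (a := c * a) (b := b) (fun σ => ⟨(hs σ).1, fun v hvu hv x hx hxv => ?_⟩) (hgF f hf) ?_⟩
  · exact (hs σ).2 v hvu hv (.inr ⟨f, hf, x, hx, hxv⟩)
  · rw [← mul_assoc, ← hc, hab]

theorem exists_isUnit_of_infinite (hS : ∀ v, IsRightLCM (S v)) [Infinite V]
    [∀ v, Nontrivial (S v)] (hΓ : IsCoconnected Γ) {F : Set (GraphProduct Γ S)}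
    (hF : IsFoundationSet F) : ∃ x ∈ F, IsUnit x := by
  by_contra! hF'
  obtain ⟨u, hu⟩ := (finite_support hF.1).exists_notMem
  obtain ⟨g, hg⟩ := exists_ne (1 : S u)
  obtain ⟨f, hf, y, hy⟩ := exists_tightWord_eq_singleton hS hΓ hF hF' hg
    fun f hf l hl => hu ⟨f, hf, ⟨u, g⟩, by simp [hl], rfl⟩
  exact hu ⟨f, hf, ⟨u, y⟩, by simp [hy], rfl⟩

theorem exists_mem_eq_of_mul (hS : ∀ v, IsRightLCM (S v)) [Nontrivial V] [∀ v, Nontrivial (S v)]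
    (hΓ : IsCoconnected Γ) {F : Set (GraphProduct Γ S)} (hF : IsFoundationSet F)
    (hF' : ∀ f ∈ F, ¬ IsUnit f) (u : V) [Infinite (S u)] :
    ∃ (y : S u) (c : GraphProduct Γ S), IsUnit c ∧ of Γ u y * c ∈ F := by
  -- Only finitely many elements of `S u` are first letters of tight words of elements of `F`.
  have hfin : (insert 1 (⋃ f ∈ F, {x : S u | ∃ l, tightWord f = ⟨u, x⟩ :: l})).Finite := by
    refine (hF.1.biUnion fun f _ => Set.Subsingleton.finite ?_).insert 1
    rintro x ⟨l, hl⟩ y ⟨m, hm⟩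
    rw [hl] at hm
    simpa using (List.cons.inj hm).1
  obtain ⟨g, hg⟩ := hfin.exists_notMem
  simp only [Set.mem_insert_iff, Set.mem_iUnion, Set.mem_ofPred_eq, not_or, not_exists] at hg
  obtain ⟨f, hf, y, hy⟩ := exists_tightWord_eq_singleton hS hΓ hF hF' hg.1 hg.2
  obtain ⟨c, hc, hfc⟩ := exists_eq_wordProd_tightWord f
  rw [hy, wordProd_cons, wordProd, List.map_nil, List.prod_nil, mul_one] at hfc
  exact ⟨y, c, hc, hfc ▸ hf⟩

open Classical in
variable (Γ S) in
/-- The canonical homomorphism from the graph product to the direct product. -/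
noncomputable def toPi : GraphProduct Γ S →* ∀ v, S v :=
  lift (MonoidHom.mulSingle S) fun v w h x y => by
    rw [MonoidHom.mulSingle_apply, MonoidHom.mulSingle_apply]
    exact Pi.mulSingle_commute h.ne x y

theorem toPi_of_same (v : V) (x : S v) : toPi Γ S (of Γ v x) v = x := by
  classical
  rw [toPi, lift_of, MonoidHom.mulSingle_apply, Pi.mulSingle_eq_same]

theorem toPi_of_ne {u v : V} (huv : u ≠ v) (y : S v) : toPi Γ S (of Γ v y) u = 1 := by
  classical
  rw [toPi, lift_of, MonoidHom.mulSingle_apply, Pi.mulSingle_eq_of_ne huv]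

/-- Up to units on the right, a non-invertible letter differs from every letter at another vertex:
compare their components at the vertex of the first one in the direct product. -/
theorem isUnit_of_of_mul_eq {u v : V} (huv : u ≠ v) {x : S u} {y : S v} {c d : GraphProduct Γ S}
    (hc : IsUnit c) (hd : IsUnit d) (h : of Γ u x * c = of Γ v y * d) : IsUnit x := by
  have hunit : ∀ {c : GraphProduct Γ S}, IsUnit c → IsUnit (toPi Γ S c u) := fun hc =>
    (hc.map (toPi Γ S)).map (Pi.evalMonoidHom S u)
  have h' := congrFun (congrArg (toPi Γ S) h) u
  rw [map_mul, map_mul, Pi.mul_apply, Pi.mul_apply, toPi_of_same, toPi_of_ne huv, one_mul] at h'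
  obtain ⟨e, he⟩ := hunit hc
  rw [← he] at h'
  exact (Units.isUnit_mul_units x e).1 (h' ▸ hunit hd)

theorem exists_isUnit_of_isAccurate (hS : ∀ v, IsRightLCM (S v)) [Nontrivial V]
    [∀ v, Nontrivial (S v)] (hΓ : IsCoconnected Γ) {u v : V} (huv : Γ.Adj u v) [Infinite (S u)]
    [Infinite (S v)] {F : Set (GraphProduct Γ S)} (hF : IsFoundationSet F) (hacc : IsAccurate F) :
    ∃ x ∈ F, IsUnit x := by
  by_contra! hF'
  obtain ⟨x, c, hc, hxF⟩ := exists_mem_eq_of_mul hS hΓ hF hF' u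
  obtain ⟨y, d, hd, hyF⟩ := exists_mem_eq_of_mul hS hΓ hF hF' v
  obtain ⟨c', hcc'⟩ := hc.exists_right_inv
  obtain ⟨d', hdd'⟩ := hd.exists_right_inv
  have heq : of Γ u x * c = of Γ v y * d := by
    by_contra hne
    refine not_orthogonal_iff.2 ⟨c' * of Γ v y, d' * of Γ u x, ?_⟩ (hacc _ hxF _ hyF hne)
    rw [mul_assoc, ← mul_assoc c, hcc', one_mul, mul_assoc, ← mul_assoc d, hdd', one_mul,
      of_comm huv]
  exact hF' _ hxF (((isUnit_of_of_mul_eq huv.ne hc hd heq).map _).mul hc)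

end Foundation

end GraphProduct

open GraphProduct in
theorem mainTheorem1 {V : Type*} [Nontrivial V] (Γ : SimpleGraph V) (hΓ : IsCoconnected Γ)
    (S : V → Type*) [∀ v, Monoid (S v)] (hS : ∀ v, IsRightLCM (S v)) [∀ v, Nontrivial (S v)] :
    (Infinite V →
      (∀ F : Set (GraphProduct Γ S), IsFoundationSet F → ∃ x ∈ F, IsUnit x) ∧
      HasAR (GraphProduct Γ S) ∧
      Function.Bijective (boundaryQuotientMap (GraphProduct Γ S))) ∧
    (Finite V → (∃ u v, Γ.Adj u v) →
      ((∃ u v, Γ.Adj u v ∧ Infinite (S u) ∧ Infinite (S v)) ∨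
        ∀ x : GraphProduct Γ S, IsUnit x) →
      (∀ F : Set (GraphProduct Γ S),
        (IsFoundationSet F ∧ IsAccurate F) ↔ ∃ x, IsUnit x ∧ F = {x}) ∧
      (HasAR (GraphProduct Γ S) ↔
        ¬ ∃ F : Set (GraphProduct Γ S), IsFoundationSet F ∧ ∀ x ∈ F, ¬ IsUnit x)) := by
  constructor
  · intro _
    have h : ∀ F : Set (GraphProduct Γ S), IsFoundationSet F → ∃ x ∈ F, IsUnit x :=
      fun F hF => exists_isUnit_of_infinite hS hΓ hF
    exact ⟨h, hasAR_of_exists_isUnit h, bijective_boundaryQuotientMap h⟩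
  · intro _ _ hcase
    have hunit : ∀ F : Set (GraphProduct Γ S), IsFoundationSet F → IsAccurate F →
        ∃ x ∈ F, IsUnit x := by
      intro F hF hacc
      rcases hcase with ⟨u, v, huv, hu, hv⟩ | hgrp
      · exact exists_isUnit_of_isAccurate hS hΓ huv hF hacc
      · obtain ⟨x, hx, -⟩ := hF.2 1
        exact ⟨x, hx, hgrp x⟩
    refine ⟨fun F => ⟨fun ⟨hF, hacc⟩ => ?_, ?_⟩, ?_, fun h => ?_⟩
    · obtain ⟨x, hx, hxu⟩ := hunit F hF hacc
      exact ⟨x, hxu, hacc.eq_singleton hx hxu⟩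
    · rintro ⟨x, hx, rfl⟩
      obtain ⟨t, ht⟩ := hx.exists_right_inv
      exact ⟨isFoundationSet_singleton ht, isAccurate_singleton x⟩
    · rintro hAR ⟨F, hF, hF'⟩
      obtain ⟨F', hfound, hacc, href⟩ := hAR F hF
      obtain ⟨x, hx, hxu⟩ := hunit F' hfound hacc
      obtain ⟨f, hf, s, rfl⟩ := href x hx
      obtain ⟨t, ht⟩ := hxu.exists_right_inv
      -- As `f` is right invertible, `{f}` is an accurate foundation set, and so `f` is invertible.
      rw [mul_assoc] at ht
      obtain ⟨_, rfl, hfu⟩ := hunit {f} (isFoundationSet_singleton ht) (isAccurate_singleton f)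
      exact hF' _ hf hfu
    · refine hasAR_of_exists_isUnit fun F hF => ?_
      by_contra! hF'
      exact h ⟨F, hF, hF'⟩
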